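/- **Corollary.** Let $K\subset\mathbb R^d$ be a convex compact set, let $C(K)$ be the space of continuous functions $f:K\to\mathbb R$ with the uniform norm $\|f\|_{C(K)}=\max_{x\in K}|f(x)|$, and let $\Delta\subset C(K)$ be the set of all convex and continuous functions on $K$. Let $E_d$ be the set of all exponential polynomials $$E(x)=\sum_{j=1}^{n}c_j\,e^{\alpha_j\cdot x}=\sum_{j=1}^{n}c_j\exp\Big\{\sum_{k=1}^{d}\alpha_{j,k}x_k\Big\},\qquad x=(x_1,\dots,x_d)\in\mathbb R^d,$$ with $n\in\mathbb N$, $c_j\in\mathbb R$ and $\alpha_j=(\alpha_{j,1},\dots,\alpha_{j,d})\in\mathbb Z_+^d$, where $\mathbb Z_+$ is the set of non-negative integers; functions in $E_d$ are regarded as elements of $C(K)$ by restriction to $K$. Then $$\Delta=\overline{E_d\cap\Delta},$$ where the bar denotes the closure in $C(K)$ with respect to the uniform norm. In particular, every continuous convex function on $K$ is a uniform limit on $K$ of exponential polynomials from $E_d$ that are themselves convex on $K$. -/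

import Mathlib

/-- The set `E_d` of exponential polynomials on `ℝ^d`: all functions
`x ↦ ∑ j, c j * exp (α j ⬝ x)`, a finite sum with real coefficients `c j` and exponent vectors
`α j` having non-negative integer coordinates. -/
def expPolynomials (d : ℕ) : Set (EuclideanSpace ℝ (Fin d) → ℝ) :=
  {E | ∃ (n : ℕ) (c : Fin n → ℝ) (α : Fin n → Fin d → ℕ),
    ∀ x, E x = ∑ j, c j * Real.exp (∑ k, (α j k : ℝ) * x k)}

/-- `E_d` viewed inside `C(K)`: the restrictions to `K` of exponential polynomials. -/
def expPolynomialsOn {d : ℕ} (K : Set (EuclideanSpace ℝ (Fin d))) : Set C(K, ℝ) :=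
  {f | ∃ E ∈ expPolynomials d, ∀ x : K, f x = E x}

/-- The set `Δ` of convex and continuous functions on `K`. Continuity is built into `C(K, ℝ)`;
as `ConvexOn` is about functions on the whole space, convexity of `f` on `K` is expressed through
a function `F` on the whole space with the same values on `K`
(the values of `F` outside `K` are irrelevant). -/
def convexContinuousOn {d : ℕ} (K : Set (EuclideanSpace ℝ (Fin d))) : Set C(K, ℝ) :=
  {f | ∃ F : EuclideanSpace ℝ (Fin d) → ℝ, ConvexOn ℝ K F ∧ ∀ x : K, f x = F x}

/-! Let `Δ` be the closed cone of convex functions in `C(K)` and `A` the algebra of exponential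
polynomials on `K`. The closed convex cone `L = closure (A ∩ Δ)` has two properties.

* `L` is stable under `⊔`. In `f ⊔ g = (f + g + |f - g|) / 2` replace `|·|` by a polynomial `q`
  close to it that is convex and `1`-Lipschitz on a large interval. The Lipschitz bound makes
  `f + g + q (f - g)` convex whenever `f` and `g` are, although `f - g` is merely a difference of
  convex functions.
* `L` contains every linear functional. By additivity it is enough to treat `c * x k`, which is
  approximated by `p (exp (x k)) + δ * exp (x k)`, where `p` is `C²`-close to `c * log` on a compact
  subinterval of `(0, ∞)` and the last summand repairs the convexity of the first.

By Hahn-Banach and compactness, a continuous convex function on `K` is a uniform limit of finite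
maxima of its affine minorants, hence lies in `L`.
-/

section PolynomialApproximation

open Polynomial Set

theorem exists_polynomial_derivative_eq_eval_eq {R : Type*} [Field R] [CharZero R] (p : R[X])
    (a c : R) : ∃ q : R[X], derivative q = p ∧ q.eval a = c := by
  obtain ⟨q, rfl⟩ : ∃ q : R[X], derivative q = p := by
    induction p using Polynomial.induction_on' with
    | add p₁ p₂ h₁ h₂ =>
      obtain ⟨q₁, rfl⟩ := h₁
      obtain ⟨q₂, rfl⟩ := h₂
      exact ⟨q₁ + q₂, derivative_add⟩
    | monomial n r =>
      refine ⟨monomial (n + 1) (r / (n + 1)), ?_⟩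
      rw [derivative_monomial_succ, div_mul_cancel₀ _ n.cast_add_one_ne_zero]
  exact ⟨q + C (c - q.eval a), by simp, by simp⟩

variable {a b : ℝ}

theorem exists_polynomial_derivative_eq_near {f f' : ℝ → ℝ} {δ : ℝ}
    (hf : ∀ t ∈ Icc a b, HasDerivWithinAt f (f' t) (Icc a b) t) {p : ℝ[X]}
    (hp : ∀ t ∈ Icc a b, |p.eval t - f' t| ≤ δ) :
    ∃ q : ℝ[X], derivative q = p ∧ ∀ t ∈ Icc a b, |q.eval t - f t| ≤ δ * (b - a) := by
  obtain ⟨q, rfl, hqa⟩ := exists_polynomial_derivative_eq_eval_eq p a (f a)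
  refine ⟨q, rfl, fun t ht => ?_⟩
  have hδ : 0 ≤ δ := (abs_nonneg _).trans (hp t ht)
  have ha : a ∈ Icc a b := left_mem_Icc.mpr (ht.1.trans ht.2)
  have hdiff := (convex_Icc a b).norm_image_sub_le_of_norm_hasDerivWithin_le
    (fun s hs => (q.hasDerivAt s).hasDerivWithinAt.sub (hf s hs)) hp ha ht
  simp only [Pi.sub_apply, hqa, sub_self, sub_zero, Real.norm_eq_abs] at hdiff
  calc |q.eval t - f t| ≤ δ * |t - a| := hdiff
    _ ≤ δ * (b - a) := by
      rw [abs_of_nonneg (sub_nonneg.mpr ht.1)]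
      gcongr
      exact ht.2

theorem exists_polynomial_near_deriv2 {f f' f'' : ℝ → ℝ}
    (hf : ∀ t ∈ Icc a b, HasDerivWithinAt f (f' t) (Icc a b) t)
    (hf' : ∀ t ∈ Icc a b, HasDerivWithinAt f' (f'' t) (Icc a b) t)
    (hf'' : ContinuousOn f'' (Icc a b)) {ε : ℝ} (hε : 0 < ε) :
    ∃ q : ℝ[X], ∀ t ∈ Icc a b, |q.eval t - f t| ≤ ε ∧
      |(derivative q).eval t - f' t| ≤ ε ∧ |(derivative (derivative q)).eval t - f'' t| ≤ ε := by
  rcases lt_or_ge b a with hba | hab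
  · exact ⟨0, fun t ht => absurd (ht.1.trans ht.2) hba.not_ge⟩
  set l := b - a
  have hl0 : 0 ≤ l := sub_nonneg.mpr hab
  set δ := ε / (1 + l) ^ 2
  have hδ : 0 < δ := by positivity
  have hδε : δ * (1 + l) ^ 2 = ε := div_mul_cancel₀ ε (by positivity)
  obtain ⟨p, hp⟩ := exists_polynomial_near_of_continuousOn a b f'' hf'' δ hδ
  obtain ⟨q', rfl, hq'⟩ := exists_polynomial_derivative_eq_near hf' fun t ht => (hp t ht).le
  obtain ⟨q, rfl, hq⟩ := exists_polynomial_derivative_eq_near hf hq'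
  refine ⟨q, fun t ht => ⟨(hq t ht).trans ?_, (hq' t ht).trans ?_, (hp t ht).le.trans ?_⟩⟩ <;>
    rw [← hδε] <;> nlinarith [mul_nonneg hδ.le hl0]

theorem exists_polynomial_convexOn_lipschitzOnWith_near {f f' f'' : ℝ → ℝ}
    (hf : ∀ t ∈ Icc a b, HasDerivWithinAt f (f' t) (Icc a b) t)
    (hf' : ∀ t ∈ Icc a b, HasDerivWithinAt f' (f'' t) (Icc a b) t)
    (hf'' : ContinuousOn f'' (Icc a b)) (hpos : ∀ t ∈ Icc a b, 0 < f'' t)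
    (hlt : ∀ t ∈ Icc a b, |f' t| < 1) {ε : ℝ} (hε : 0 < ε) :
    ∃ q : ℝ[X], ConvexOn ℝ (Icc a b) q.eval ∧ LipschitzOnWith 1 q.eval (Icc a b) ∧
      ∀ t ∈ Icc a b, |q.eval t - f t| ≤ ε := by
  have hcont : ContinuousOn (fun t => min (f'' t) (1 - |f' t|)) (Icc a b) :=
    hf''.inf (continuousOn_const.sub fun t ht => (hf' t ht).continuousWithinAt.abs)
  obtain ⟨η, hη, hη'⟩ := isCompact_Icc.exists_forall_le' hcont
    fun t ht => lt_min (hpos t ht) (sub_pos.mpr (hlt t ht))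
  obtain ⟨q, hq⟩ := exists_polynomial_near_deriv2 hf hf' hf'' (lt_min hε hη)
  refine ⟨q, ?_, ?_, fun t ht => (hq t ht).1.trans (min_le_left _ _)⟩
  · refine convexOn_of_hasDerivWithinAt2_nonneg (convex_Icc a b) q.continuousOn
      (fun t _ => (q.hasDerivAt t).hasDerivWithinAt)
      (fun t _ => ((derivative q).hasDerivAt t).hasDerivWithinAt) fun t ht => ?_
    have ht := interior_subset ht
    have hnear := (abs_le.mp ((hq t ht).2.2.trans (min_le_right _ _))).1
    linarith [(hη' t ht).trans (min_le_left _ _)]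
  · refine (convex_Icc a b).lipschitzOnWith_of_nnnorm_hasDerivWithin_le
      (fun t _ => (q.hasDerivAt t).hasDerivWithinAt) fun t ht => ?_
    have hnear := (hq t ht).2.1.trans (min_le_right _ _)
    rw [← NNReal.coe_le_coe, coe_nnnorm, NNReal.coe_one, Real.norm_eq_abs]
    linarith [(hη' t ht).trans (min_le_right _ _),
      abs_sub_abs_le_abs_sub ((derivative q).eval t) (f' t)]

theorem hasDerivAt_sqrt_sq_add_sq {δ : ℝ} (hδ : δ ≠ 0) (t : ℝ) :
    HasDerivAt (fun t => √(t ^ 2 + δ ^ 2)) (t / √(t ^ 2 + δ ^ 2)) t := by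
  have hpos : 0 < t ^ 2 + δ ^ 2 := by positivity
  convert ((hasDerivAt_pow 2 t).add_const (δ ^ 2)).sqrt hpos.ne' using 1
  rw [Nat.cast_ofNat, Nat.add_one_sub_one, pow_one, mul_div_mul_left _ _ two_ne_zero]

theorem hasDerivAt_div_sqrt_sq_add_sq {δ : ℝ} (hδ : δ ≠ 0) (t : ℝ) :
    HasDerivAt (fun t => t / √(t ^ 2 + δ ^ 2)) (δ ^ 2 / √(t ^ 2 + δ ^ 2) ^ 3) t := by
  have hpos : 0 < t ^ 2 + δ ^ 2 := by positivity
  have hsqrt : √(t ^ 2 + δ ^ 2) ≠ 0 := (Real.sqrt_pos.mpr hpos).ne'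
  have hsq : √(t ^ 2 + δ ^ 2) ^ 2 = t ^ 2 + δ ^ 2 := Real.sq_sqrt hpos.le
  refine ((hasDerivAt_id' t).div (hasDerivAt_sqrt_sq_add_sq hδ t) hsqrt).congr_deriv ?_
  generalize √(t ^ 2 + δ ^ 2) = r at hsqrt hsq
  field_simp
  linarith

theorem exists_polynomial_convexOn_lipschitzOnWith_near_abs (M : ℝ) {ε : ℝ} (hε : 0 < ε) :
    ∃ q : ℝ[X], ConvexOn ℝ (Icc (-M) M) q.eval ∧ LipschitzOnWith 1 q.eval (Icc (-M) M) ∧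
      ∀ t ∈ Icc (-M) M, dist (q.eval t) |t| ≤ ε := by
  set δ := ε / 2
  have hδ : 0 < δ := half_pos hε
  have hδε : δ + δ = ε := add_halves ε
  have hpos (t : ℝ) : 0 < √(t ^ 2 + δ ^ 2) := Real.sqrt_pos.mpr (by positivity)
  have abs_lt_sqrt (t : ℝ) : |t| < √(t ^ 2 + δ ^ 2) :=
    Real.lt_sqrt_of_sq_lt (by rw [sq_abs]; exact lt_add_of_pos_right _ (by positivity))
  have sqrt_le_abs_add (t : ℝ) : √(t ^ 2 + δ ^ 2) ≤ |t| + δ := by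
    refine Real.sqrt_le_iff.mpr ⟨by positivity, ?_⟩
    nlinarith [sq_abs t, abs_nonneg t]
  obtain ⟨q, hconv, hlip, hnear⟩ := exists_polynomial_convexOn_lipschitzOnWith_near
    (a := -M) (b := M)
    (fun t _ => (hasDerivAt_sqrt_sq_add_sq hδ.ne' t).hasDerivWithinAt)
    (fun t _ => (hasDerivAt_div_sqrt_sq_add_sq hδ.ne' t).hasDerivWithinAt)
    (continuousOn_const.div (by fun_prop) fun t _ => (pow_pos (hpos t) 3).ne')
    (fun t _ => div_pos (by positivity) (pow_pos (hpos t) 3))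
    (fun t _ => by rw [abs_div, abs_of_pos (hpos t), div_lt_one (hpos t)]; exact abs_lt_sqrt t) hδ
  refine ⟨q, hconv, hlip, fun t ht => ?_⟩
  have h := abs_le.mp (hnear t ht)
  exact abs_le.mpr ⟨by linarith [abs_lt_sqrt t], by linarith [sqrt_le_abs_add t]⟩

theorem hasDerivAt_polynomial_comp_exp (q : ℝ[X]) (t : ℝ) :
    HasDerivAt (fun t => q.eval (Real.exp t)) ((X * derivative q).eval (Real.exp t)) t := by
  simpa [mul_comm, Function.comp_def] using (q.hasDerivAt _).comp t (Real.hasDerivAt_exp t)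

theorem convexOn_polynomial_comp_exp {s : Set ℝ} (hs : Convex ℝ s) {q : ℝ[X]}
    (hq : ∀ t ∈ s, 0 ≤ (derivative (X * derivative q)).eval (Real.exp t)) :
    ConvexOn ℝ s fun t => q.eval (Real.exp t) := by
  refine convexOn_of_hasDerivWithinAt2_nonneg hs (by fun_prop)
    (fun t _ => (hasDerivAt_polynomial_comp_exp q t).hasDerivWithinAt)
    (fun t _ => (hasDerivAt_polynomial_comp_exp _ t).hasDerivWithinAt) fun t ht => ?_
  rw [eval_mul, eval_X]
  exact mul_nonneg (Real.exp_pos t).le (hq t (interior_subset ht))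

theorem exists_polynomial_near_const_mul_log (c : ℝ) {a b : ℝ} (ha : 0 < a) {ε : ℝ} (hε : 0 < ε) :
    ∃ p : ℝ[X], ∀ y ∈ Icc a b, |p.eval y - c * Real.log y| ≤ ε ∧
      |(derivative (X * derivative p)).eval y| ≤ ε := by
  have hpos {y : ℝ} (hy : y ∈ Icc a b) : 0 < y := ha.trans_le hy.1
  set δ := ε / (1 + |b|)
  have hδ : 0 < δ := by positivity
  have hδε : δ * (1 + |b|) = ε := div_mul_cancel₀ ε (by positivity)
  obtain ⟨p, hp⟩ := exists_polynomial_near_deriv2 (a := a) (b := b)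
    (f := fun y => c * Real.log y) (f' := fun y => c * y⁻¹) (f'' := fun y => c * -(y ^ 2)⁻¹)
    (fun y hy => ((Real.hasDerivAt_log (hpos hy).ne').const_mul c).hasDerivWithinAt)
    (fun y hy => ((hasDerivAt_inv (hpos hy).ne').const_mul c).hasDerivWithinAt)
    (continuousOn_const.mul
      ((continuousOn_id.pow 2).inv₀ fun y hy => (pow_pos (hpos hy) 2).ne').neg) hδ
  refine ⟨p, fun y hy => ?_⟩
  obtain ⟨h, h', h''⟩ := hp y hy
  have hy0 := hpos hy
  have hyb : y ≤ |b| := hy.2.trans (le_abs_self b)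
  refine ⟨h.trans (by nlinarith [abs_nonneg b]), ?_⟩
  -- The operator `X * d/dX` maps `c * log` to a constant, so the derivative of its value at `p` is
  -- small for every `p` that is `C²`-close to `c * log`.
  calc |(derivative (X * derivative p)).eval y|
      = |((derivative p).eval y - c * y⁻¹) +
          y * ((derivative (derivative p)).eval y - c * -(y ^ 2)⁻¹)| := by
        simp only [derivative_mul, derivative_X, eval_add, eval_mul, eval_X, eval_one]
        congr 1
        field_simp
        ring
    _ ≤ δ + y * δ := by
        refine (abs_add_le _ _).trans (add_le_add h' ?_)
        rw [abs_mul, abs_of_pos hy0]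
        gcongr
    _ ≤ ε := by
        rw [← hδε, mul_add, mul_one, mul_comm y]
        gcongr

theorem exists_polynomial_convexOn_comp_exp_near_const_mul (c R : ℝ) {ε : ℝ} (hε : 0 < ε) :
    ∃ q : ℝ[X], ConvexOn ℝ (Icc (-R) R) (fun t => q.eval (Real.exp t)) ∧
      ∀ t ∈ Icc (-R) R, |q.eval (Real.exp t) - c * t| ≤ ε := by
  have hexp {t : ℝ} (ht : t ∈ Icc (-R) R) :
      Real.exp t ∈ Icc (Real.exp (-R)) (Real.exp R) :=
    ⟨Real.exp_le_exp.mpr ht.1, Real.exp_le_exp.mpr ht.2⟩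
  set δ := ε / (1 + Real.exp R)
  have hδ : 0 < δ := by positivity
  have hδε : δ * (1 + Real.exp R) = ε := div_mul_cancel₀ ε (by positivity)
  obtain ⟨p, hp⟩ := exists_polynomial_near_const_mul_log c (b := Real.exp R) (Real.exp_pos (-R)) hδ
  refine ⟨p + C δ * X, convexOn_polynomial_comp_exp (convex_Icc _ _) fun t ht => ?_,
    fun t ht => ?_⟩
  · have h := abs_le.mp (hp _ (hexp ht)).2
    have hderiv : derivative (X * derivative (p + C δ * X)) =
        derivative (X * derivative p) + C δ := by
      simp [mul_add, add_assoc]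
    rw [hderiv, eval_add, eval_C]
    linarith
  · have h := abs_le.mp (hp _ (hexp ht)).1
    rw [Real.log_exp] at h
    have hpos : 0 ≤ δ * Real.exp t := by positivity
    have hle : δ * Real.exp t ≤ δ * Real.exp R := by gcongr; exact ht.2
    simp only [eval_add, eval_mul, eval_C, eval_X]
    exact abs_le.mpr ⟨by linarith, by linarith⟩

end PolynomialApproximation

section ConvexMaps

open Polynomial Set

section Cone

variable {E : Type*} [AddCommMonoid E] [Module ℝ E] [TopologicalSpace E] {K : Set E}

/-- The cone of continuous functions on `K` that are convex on `K`. The convexity inequality is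
only required when the convex combination lies in `K`, so that no extension to the whole space
has to be chosen. -/
def convexMaps (K : Set E) : PointedCone ℝ C(K, ℝ) where
  carrier := {f | ∀ (x y z : K) (a b : ℝ), 0 ≤ a → 0 ≤ b → a + b = 1 →
    (z : E) = a • (x : E) + b • (y : E) → f z ≤ a * f x + b * f y}
  add_mem' hf hg x y z a b ha hb hab hz := by
    have hfz := hf x y z a b ha hb hab hz
    have hgz := hg x y z a b ha hb hab hz
    simp only [ContinuousMap.add_apply]
    linarith
  zero_mem' := by simp
  smul_mem' c f hf x y z a b ha hb hab hz := by
    calc c.1 * f z ≤ c.1 * (a * f x + b * f y) :=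
          mul_le_mul_of_nonneg_left (hf x y z a b ha hb hab hz) c.2
      _ = a * (c.1 * f x) + b * (c.1 * f y) := by ring

theorem mem_convexMaps_iff_exists_convexOn (hK : Convex ℝ K) {f : C(K, ℝ)} :
    f ∈ convexMaps K ↔ ∃ F : E → ℝ, ConvexOn ℝ K F ∧ ∀ x : K, f x = F x := by
  constructor
  · intro hf
    have hext (x : K) : Function.extend Subtype.val f 0 (x : E) = f x :=
      Subtype.val_injective.extend_apply f 0 x
    refine ⟨Function.extend Subtype.val f 0, ⟨hK, ?_⟩, fun x => (hext x).symm⟩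
    intro x hx y hy a b ha hb hab
    lift x to K using hx
    lift y to K using hy
    rw [hext, hext]
    exact (hext ⟨_, hK x.2 y.2 ha hb hab⟩).trans_le (hf x y _ a b ha hb hab rfl)
  · rintro ⟨F, hF, hfF⟩ x y z a b ha hb hab hz
    simpa only [hfF, hz, smul_eq_mul] using hF.2 x.2 y.2 ha hb hab

theorem isClosed_convexMaps (K : Set E) : IsClosed (convexMaps K : Set C(K, ℝ)) := by
  have heq : (convexMaps K : Set C(K, ℝ)) = ⋂ (x : K) (y : K) (z : K) (a : ℝ) (b : ℝ) (_ : 0 ≤ a)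
      (_ : 0 ≤ b) (_ : a + b = 1) (_ : (z : E) = a • (x : E) + b • (y : E)),
      {f : C(K, ℝ) | f z ≤ a * f x + b * f y} := by
    ext f
    simp only [mem_iInter]
    rfl
  rw [heq]
  exact isClosed_iInter fun x => isClosed_iInter fun y => isClosed_iInter fun z =>
    isClosed_iInter fun a => isClosed_iInter fun b => isClosed_iInter fun _ =>
    isClosed_iInter fun _ => isClosed_iInter fun _ => isClosed_iInter fun _ =>
    isClosed_le (by fun_prop) (by fun_prop)

theorem add_add_mem_convexMaps {f g k : C(K, ℝ)} (hf : f ∈ convexMaps K) (hg : g ∈ convexMaps K)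
    {s : Set ℝ} {h : ℝ → ℝ} (hconv : ConvexOn ℝ s h) (hlip : LipschitzOnWith 1 h s)
    (hs : ∀ x, f x - g x ∈ s) (hk : ∀ x, k x = h (f x - g x)) : f + g + k ∈ convexMaps K := by
  -- The convexity defect of `h ∘ (f - g)` is at most the sum of the convexity gains of `f` and `g`.
  intro x y z a b ha hb hab hz
  have hfz := hf x y z a b ha hb hab hz
  have hgz := hg x y z a b ha hb hab hz
  set w := a * (f x - g x) + b * (f y - g y) with hw
  have hws : w ∈ s := hconv.1 (hs x) (hs y) ha hb hab
  have hle : |(f z - g z) - w| ≤ (a * f x + b * f y - f z) + (a * g x + b * g y - g z) :=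
    abs_le.mpr ⟨by linarith [hw], by linarith [hw]⟩
  have hkz : k z ≤ h w + |(f z - g z) - w| := by
    have hdist := hlip.dist_le_mul _ (hs z) _ hws
    rw [NNReal.coe_one, one_mul, Real.dist_eq, Real.dist_eq] at hdist
    rw [hk]
    linarith [le_abs_self (h (f z - g z) - h w)]
  have hwk : h w ≤ a * k x + b * k y := by
    simpa only [hk, smul_eq_mul] using hconv.2 (hs x) (hs y) ha hb hab
  simp only [ContinuousMap.add_apply]
  linarith

/-- The cone of those elements of a subalgebra of `C(K, ℝ)` that are convex; its closure consists of
the functions that can be approximated convexly from the subalgebra. -/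
def convexPart (A : Subalgebra ℝ C(K, ℝ)) : PointedCone ℝ C(K, ℝ) :=
  A.toSubmodule.restrictScalars _ ⊓ convexMaps K

theorem algebraMap_mem_convexPart (A : Subalgebra ℝ C(K, ℝ)) (c : ℝ) :
    algebraMap ℝ C(K, ℝ) c ∈ convexPart A := by
  refine ⟨A.algebraMap_mem c, fun x y z a b _ _ hab _ => le_of_eq ?_⟩
  change c = a * c + b * c
  rw [← add_mul, hab, one_mul]

variable [CompactSpace K] {A : Subalgebra ℝ C(K, ℝ)}

theorem sup_mem_closure_of_mem_convexPart {f g : C(K, ℝ)} (hf : f ∈ convexPart A)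
    (hg : g ∈ convexPart A) : f ⊔ g ∈ (convexPart A).closure := by
  refine Metric.mem_closure_iff.mpr fun ε hε => ?_
  have hmem (x : K) : f x - g x ∈ Icc (-‖f - g‖) ‖f - g‖ :=
    abs_le.mp ((f - g).norm_coe_le_norm x)
  obtain ⟨q, hconv, hlip, hq⟩ := exists_polynomial_convexOn_lipschitzOnWith_near_abs ‖f - g‖ hε
  have hqA : aeval (f - g) q ∈ A :=
    Algebra.adjoin_singleton_le (A.sub_mem hf.1 hg.1) (aeval_mem_adjoin_singleton ℝ (f - g))
  have hqconv : f + g + aeval (f - g) q ∈ convexMaps K :=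
    add_add_mem_convexMaps hf.2 hg.2 hconv hlip hmem fun x => by simp
  refine ⟨(2⁻¹ : ℝ) • (f + g + aeval (f - g) q), (convexPart A).smul_mem (by norm_num)
    ⟨A.add_mem (A.add_mem hf.1 hg.1) hqA, hqconv⟩, ?_⟩
  refine (ContinuousMap.dist_lt_iff hε).mpr fun x => ?_
  have hx := hq _ (hmem x)
  calc dist ((f ⊔ g) x) (((2⁻¹ : ℝ) • (f + g + aeval (f - g) q)) x)
      = 2⁻¹ * dist (q.eval (f x - g x)) |f x - g x| := by
        rw [ContinuousMap.sup_apply, sup_eq_half_smul_add_add_abs_sub' ℝ, ContinuousMap.smul_apply,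
          dist_smul₀, ContinuousMap.add_apply, ContinuousMap.add_apply,
          aeval_continuousMap_apply, dist_add_left, dist_comm, abs_sub_comm,
          ContinuousMap.sub_apply, Real.norm_of_nonneg (by norm_num)]
    _ < ε := by linarith

theorem sup_mem_closure_convexPart {f g : C(K, ℝ)} (hf : f ∈ (convexPart A).closure)
    (hg : g ∈ (convexPart A).closure) : f ⊔ g ∈ (convexPart A).closure := by
  have hcont : Continuous fun p : C(K, ℝ) × C(K, ℝ) => p.1 ⊔ p.2 :=
    ContinuousMap.continuous_of_continuous_uncurry _ <| by
      change Continuous fun p : (C(K, ℝ) × C(K, ℝ)) × K => p.1.1 p.2 ⊔ p.1.2 p.2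
      fun_prop
  have h := map_mem_closure₂ hcont hf hg fun f hf g hg => sup_mem_closure_of_mem_convexPart hf hg
  exact closure_closure.subset h

theorem smul_restrict_mem_closure_convexPart {l : E →L[ℝ] ℝ} {e : C(K, ℝ)} (he : e ∈ A)
    (hel : ∀ x : K, e x = Real.exp (l x)) (c : ℝ) :
    c • ContinuousMap.restrict K (l : C(E, ℝ)) ∈ (convexPart A).closure := by
  refine Metric.mem_closure_iff.mpr fun ε hε => ?_
  set R := ‖ContinuousMap.restrict K (l : C(E, ℝ))‖
  have hR (x : K) : l x ∈ Icc (-R) R :=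
    abs_le.mp ((ContinuousMap.restrict K (l : C(E, ℝ))).norm_coe_le_norm x)
  obtain ⟨q, hconv, hq⟩ := exists_polynomial_convexOn_comp_exp_near_const_mul c R (half_pos hε)
  have heval (x : K) : aeval e q x = q.eval (Real.exp (l x)) := by
    rw [aeval_continuousMap_apply, hel]
  refine ⟨aeval e q, ⟨Algebra.adjoin_singleton_le he (aeval_mem_adjoin_singleton ℝ e), ?_⟩, ?_⟩
  · intro x y z a b ha hb hab hz
    rw [heval, heval, heval, hz, map_add, map_smul, map_smul]
    exact hconv.2 (hR x) (hR y) ha hb hab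
  · refine (ContinuousMap.dist_lt_iff hε).mpr fun x => ?_
    rw [dist_comm, heval]
    exact (hq _ (hR x)).trans_lt (half_lt_self hε)

end Cone

section Affine

variable {E : Type*} [AddCommGroup E] [Module ℝ E] [TopologicalSpace E] [IsTopologicalAddGroup E]
  [ContinuousSMul ℝ E] [LocallyConvexSpace ℝ E] {K : Set E}

theorem exists_affine_le_of_mem_convexMaps (hK : Convex ℝ K) (hK' : IsClosed K) {f : C(K, ℝ)}
    (hf : f ∈ convexMaps K) {x : K} {a : ℝ} (ha : a < f x) :
    ∃ (l : E →L[ℝ] ℝ) (c : ℝ), (∀ y : K, l y + c ≤ f y) ∧ l x + c = a := by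
  obtain ⟨F, hF, hfF⟩ := (mem_convexMaps_iff_exists_convexOn hK).mp hf
  have hcont : ContinuousOn F K := by
    rw [continuousOn_iff_continuous_domRestrict]
    exact f.continuous.congr hfF
  obtain ⟨l, c, hle, heq⟩ := hF.exists_affine_le_of_lt (𝕜 := ℝ) x.2 (hfF x ▸ ha) hK'
    hcont.lowerSemicontinuousOn
  exact ⟨l, c, fun y => (hle y).trans_eq (hfF y).symm, heq⟩

theorem mem_closure_of_sup_mem_of_affine_mem [CompactSpace K] (hK : Convex ℝ K) (hK' : IsClosed K)
    {L : Set C(K, ℝ)}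
    (hsup : ∀ f ∈ L, ∀ g ∈ L, f ⊔ g ∈ L)
    (haff : ∀ (l : E →L[ℝ] ℝ) (c : ℝ),
      ContinuousMap.restrict K (l : C(E, ℝ)) + algebraMap ℝ C(K, ℝ) c ∈ L)
    {f : C(K, ℝ)} (hf : f ∈ convexMaps K) : f ∈ closure L := by
  refine Metric.mem_closure_iff.mpr fun ε hε => ?_
  have hminor (x : K) : ∃ g ∈ L, g ≤ f ∧ f x - g x < ε := by
    obtain ⟨l, c, hle, heq⟩ :=
      exists_affine_le_of_mem_convexMaps hK hK' hf (sub_lt_self (f x) (half_pos hε))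
    refine ⟨_, haff l c, hle, ?_⟩
    change f x - (l x + c) < ε
    linarith
  choose g hgL hgf hfg using hminor
  rcases isEmpty_or_nonempty K with hempty | ⟨⟨x₀⟩⟩
  · exact ⟨_, haff 0 0, (ContinuousMap.dist_lt_iff hε).mpr fun x => hempty.elim x⟩
  obtain ⟨t, -, ht⟩ := isCompact_univ.elim_nhds_subcover (fun x => {y | f y - g x y < ε})
    fun x _ => (isOpen_lt (by fun_prop) continuous_const).mem_nhds (hfg x)
  have hcover (y : K) : ∃ x ∈ t, f y - g x y < ε := by simpa using ht (mem_univ y)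
  obtain ⟨x₁, hx₁, -⟩ := hcover x₀
  refine ⟨t.sup' ⟨x₁, hx₁⟩ g, Finset.sup'_mem L hsup t _ g fun x _ => hgL x, ?_⟩
  refine (ContinuousMap.dist_lt_iff hε).mpr fun y => ?_
  obtain ⟨x, hxt, hxy⟩ := hcover y
  have hle : t.sup' ⟨x₁, hx₁⟩ g y ≤ f y := Finset.sup'_le _ _ (fun x _ => hgf x) y
  have hge : g x y ≤ t.sup' ⟨x₁, hx₁⟩ g y := Finset.le_sup' g hxt y
  exact abs_sub_lt_iff.mpr ⟨by linarith, by linarith⟩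

theorem closure_convexPart_eq_convexMaps [CompactSpace K] (hK : Convex ℝ K) (hK' : IsClosed K)
    {A : Subalgebra ℝ C(K, ℝ)}
    (hA : ∀ l : E →L[ℝ] ℝ, ContinuousMap.restrict K (l : C(E, ℝ)) ∈ (convexPart A).closure) :
    (convexPart A).closure = convexMaps K := by
  apply le_antisymm
  · exact closure_minimal inter_subset_right (isClosed_convexMaps K)
  · intro f hf
    refine closure_closure.subset (mem_closure_of_sup_mem_of_affine_mem hK hK'
      (fun f hf g hg => sup_mem_closure_convexPart hf hg) (fun l c => ?_) hf)
    exact (convexPart A).closure.add_mem (hA l) (subset_closure (algebraMap_mem_convexPart A c))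

end Affine

end ConvexMaps

section ExponentialPolynomials

open Set

variable {d : ℕ}

theorem sum_mem_expPolynomials {ι : Type*} [Fintype ι] (c : ι → ℝ) (α : ι → Fin d → ℕ) :
    (fun x => ∑ j, c j * Real.exp (∑ k, (α j k : ℝ) * x k)) ∈ expPolynomials d :=
  ⟨Fintype.card ι, c ∘ (Fintype.equivFin ι).symm, α ∘ (Fintype.equivFin ι).symm, fun x =>
    ((Fintype.equivFin ι).symm.sum_comp
      fun j => c j * Real.exp (∑ k, (α j k : ℝ) * x k)).symm⟩

theorem const_mem_expPolynomials (a : ℝ) : (fun _ => a) ∈ expPolynomials d :=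
  ⟨1, fun _ => a, fun _ _ => 0, fun x => by simp⟩

theorem exp_apply_mem_expPolynomials (k : Fin d) :
    (fun x => Real.exp (x k)) ∈ expPolynomials d :=
  ⟨1, fun _ => 1, fun _ => Pi.single k 1, fun x => by simp [Pi.single_apply]⟩

theorem add_mem_expPolynomials {f g : EuclideanSpace ℝ (Fin d) → ℝ}
    (hf : f ∈ expPolynomials d) (hg : g ∈ expPolynomials d) : f + g ∈ expPolynomials d := by
  obtain ⟨n, c, α, hf⟩ := hf
  obtain ⟨m, b, β, hg⟩ := hg
  convert sum_mem_expPolynomials (Sum.elim c b) (Sum.elim α β) using 2 with x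
  simp [hf, hg]

theorem mul_mem_expPolynomials {f g : EuclideanSpace ℝ (Fin d) → ℝ}
    (hf : f ∈ expPolynomials d) (hg : g ∈ expPolynomials d) : f * g ∈ expPolynomials d := by
  obtain ⟨n, c, α, hf⟩ := hf
  obtain ⟨m, b, β, hg⟩ := hg
  convert sum_mem_expPolynomials (fun p : Fin n × Fin m => c p.1 * b p.2)
    (fun p => α p.1 + β p.2) using 1
  ext x
  rw [Pi.mul_apply, hf, hg, Finset.sum_mul_sum, Fintype.sum_prod_type]
  refine Finset.sum_congr rfl fun i _ => Finset.sum_congr rfl fun j _ => ?_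
  simp only [Pi.add_apply, Nat.cast_add, add_mul, Finset.sum_add_distrib, Real.exp_add]
  ring

variable (K : Set (EuclideanSpace ℝ (Fin d)))

/-- The exponential polynomials on `K` as a subalgebra of `C(K, ℝ)`. -/
def expPolynomialSubalgebra : Subalgebra ℝ C(K, ℝ) where
  carrier := expPolynomialsOn K
  add_mem' := by
    rintro f g ⟨F, hF, hfF⟩ ⟨G, hG, hgG⟩
    exact ⟨F + G, add_mem_expPolynomials hF hG, fun x => by simp [hfF, hgG]⟩
  mul_mem' := by
    rintro f g ⟨F, hF, hfF⟩ ⟨G, hG, hgG⟩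
    exact ⟨F * G, mul_mem_expPolynomials hF hG, fun x => by simp [hfF, hgG]⟩
  algebraMap_mem' c := ⟨fun _ => c, const_mem_expPolynomials c, fun x => by simp⟩

variable {K}

theorem convexContinuousOn_eq_convexMaps (hK : Convex ℝ K) :
    convexContinuousOn K = convexMaps K :=
  ext fun _ => (mem_convexMaps_iff_exists_convexOn hK).symm

theorem restrict_mem_closure_convexPart_expPolynomialSubalgebra [CompactSpace K]
    (l : EuclideanSpace ℝ (Fin d) →L[ℝ] ℝ) :
    ContinuousMap.restrict K (l : C(EuclideanSpace ℝ (Fin d), ℝ)) ∈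
      (convexPart (expPolynomialSubalgebra K)).closure := by
  have hsum : ContinuousMap.restrict K (l : C(EuclideanSpace ℝ (Fin d), ℝ)) =
      ∑ k, l (EuclideanSpace.single k 1) • ContinuousMap.restrict K
        (EuclideanSpace.proj k : EuclideanSpace ℝ (Fin d) →L[ℝ] ℝ) := by
    ext x
    calc l x = l (∑ k, x.1 k • EuclideanSpace.single k 1) := by
          congr 1
          simpa using ((EuclideanSpace.basisFun (Fin d) ℝ).sum_repr x.1).symm
      _ = _ := by simp [mul_comm]
  rw [hsum]
  refine Submodule.sum_mem _ fun k _ => smul_restrict_mem_closure_convexPart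
    (e := ⟨fun x : K => Real.exp (x.1 k), by fun_prop⟩) ?_ (fun x => rfl) _
  exact ⟨_, exp_apply_mem_expPolynomials k, fun x => rfl⟩

end ExponentialPolynomials

/-- For compact `K` the topology of `C(K, ℝ)` is that of the uniform norm on `K`, so `closure`
is the closure with respect to uniform convergence on `K`. -/
theorem mainTheorem5 (d : ℕ) (K : Set (EuclideanSpace ℝ (Fin d)))
    (hconv : Convex ℝ K) (hcomp : IsCompact K) :
    convexContinuousOn K = closure (expPolynomialsOn K ∩ convexContinuousOn K) := by
  have : CompactSpace K := isCompact_iff_compactSpace.mp hcomp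
  calc convexContinuousOn K = convexMaps K := convexContinuousOn_eq_convexMaps hconv
    _ = (convexPart (expPolynomialSubalgebra K)).closure := by
      rw [closure_convexPart_eq_convexMaps hconv hcomp.isClosed
        restrict_mem_closure_convexPart_expPolynomialSubalgebra]
    _ = closure (expPolynomialsOn K ∩ convexContinuousOn K) := by
      rw [convexContinuousOn_eq_convexMaps hconv]
      rfl
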